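/- Let $Q$ be a finite-dimensional smooth manifold (Hausdorff, second countable) and let $l\in C^\infty(TQ)$ be a Lagrangian. Let $\pi:T^*Q\to Q$ be the projection, $\vartheta_0$ the fundamental one-form on $T^*Q$, $\langle\vartheta_0,w\rangle=\langle p,T\pi(w)\rangle$ for $w\in T_p(T^*Q)$, and $\omega=d\vartheta_0$. For $f,g\in C^\infty(T^*Q)$ let $X_f$ be the vector field with $\omega(X_f,\cdot)=-df$, and let $\{f,g\}=X_g f$. Let $\mathscr{L}:TQ\to T^*Q$ be the Legendre transformation, i.e. the fibre derivative $\langle\mathscr{L}(v),w\rangle=\frac{d}{ds}l(v+sw)|_{s=0}$ for $v,w\in T_qQ$, and let $e(v)=\langle\mathscr{L}(v),v\rangle-l(v)$ be the energy. For a smooth curve $\gamma$ in $Q$ write $j^1\gamma(t)=\dot\gamma(t)\in TQ$; $\gamma$ is a solution of the Euler–Lagrange equations if $\frac{d}{dt}\frac{\partial l}{\partial\dot x}=\frac{\partial l}{\partial x}$ holds along $\gamma$ in local coordinates. Let $\mathscr{P}=\mathscr{L}(TQ)$ be the primary constraint set. Let $\mathscr{D}\subseteq TQ$ be the set of all vectors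 $j^1\gamma(0)$, where $\gamma:(-\varepsilon,\varepsilon)\to Q$, $\varepsilon>0$, is a smooth solution of the Euler–Lagrange equations, and let $\mathscr{C}=\mathscr{L}(\mathscr{D})$ be the constraint set. A constraint function is a function $c\in C^\infty(T^*Q)$ that vanishes on $\mathscr{C}$. A function $f\in C^\infty(T^*Q)$ is first class if $\{f,c\}$ is a constraint function for every constraint function $c$. Assume that $\mathscr{P}$ is an embedded submanifold of $T^*Q$, that $\mathscr{L}$ is a submersion of $TQ$ onto $\mathscr{P}$, and that $h\in C^\infty(T^*Q)$ satisfies $h\circ\mathscr{L}=e$ (that is, $h$ is a smooth extension of the push-forward of the energy to $\mathscr{P}$). Theorem. Let $I\subseteq\mathbb{R}$ be an open interval and let $\gamma:I\to Q$ be a smooth solution of the Euler–Lagrange equations. Then for every first class function $f$ and every $t\in I$ the function $s\mapsto f(\mathscr{L}j^1\gamma(s))$ is differentiable at $t$ and $$\frac{d}{dt}f(\mathscr{L}j^1\gamma(t))=\{f,h\}(\mathscr{L}j^1\gamma(t)).$$ -/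

import Mathlib

open Set Filter Topology
open scoped Manifold ContDiff

noncomputable section

namespace DiracConstraints

section Submanifolds

variable {F : Type*} [NormedAddCommGroup F] [NormedSpace ℝ F]
  {H : Type*} [TopologicalSpace H] (J : ModelWithCorners ℝ F H)
  {M : Type*} [TopologicalSpace M] [ChartedSpace H M]

/-- `φ` is a smooth chart of `M` in which the subset `S` is the linear slice `W`: a point `x` of
the domain of `φ` lies in `S` if and only if its coordinates lie in the linear subspace `W`. -/
structure IsSliceChart (S : Set M) (φ : OpenPartialHomeomorph M H) (W : Submodule ℝ F) :
    Prop where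
  mem_maximalAtlas : φ ∈ IsManifold.maximalAtlas J ∞ M
  mem_iff : ∀ x ∈ φ.source, x ∈ S ↔ φ.extend J x ∈ W

/-- `S` is an embedded smooth submanifold of `M` (every point of `S` has a slice chart). -/
def IsEmbeddedSubmanifold (S : Set M) : Prop :=
  ∀ p ∈ S, ∃ (φ : OpenPartialHomeomorph M H) (W : Submodule ℝ F),
    p ∈ φ.source ∧ IsSliceChart J S φ W

/-- The tangent space at `p` of the embedded submanifold `S`, as a subset of `T_p M`: the vectors
whose coordinates in a slice chart about `p` lie in the slice. (For an embedded submanifold this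
does not depend on the slice chart.) -/
def submanifoldTangentSpace (S : Set M) (p : M) : Set (TangentSpace J p) :=
  {w | ∃ (φ : OpenPartialHomeomorph M H) (W : Submodule ℝ F),
    p ∈ φ.source ∧ IsSliceChart J S φ W ∧
      (mfderiv J 𝓘(ℝ, F) (φ.extend J) p w : F) ∈ W}

end Submanifolds

variable {E : Type*} [NormedAddCommGroup E] [NormedSpace ℝ E]
  {Q : Type*} [TopologicalSpace Q] [ChartedSpace E Q] [IsManifold 𝓘(ℝ, E) ∞ Q]

variable (E Q) in
/-- The cotangent bundle `T*Q`, as the bundle of continuous linear maps from the tangent bundle to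
the trivial line bundle. -/
abbrev CotangentBundle : Type _ :=
  Bundle.TotalSpace (E →L[ℝ] ℝ)
    (fun q : Q => TangentSpace 𝓘(ℝ, E) q →L[ℝ] Bundle.Trivial Q ℝ q)

variable (E) in
/-- The model with corners of the cotangent bundle, a manifold modelled on `E × E*`. -/
abbrev cotangentModel :
    ModelWithCorners ℝ (E × (E →L[ℝ] ℝ)) (ModelProd E (E →L[ℝ] ℝ)) :=
  𝓘(ℝ, E).prod 𝓘(ℝ, E →L[ℝ] ℝ)

/-! ### The canonical symplectic structure of the cotangent bundle -/

/-- The fundamental one-form `ϑ₀` of `T*Q`: `ϑ₀(w) = ⟨a, Tπ w⟩` for `w` tangent to `T*Q` at `a`. -/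
def fundamentalForm (a : CotangentBundle E Q) : TangentSpace (cotangentModel E) a →L[ℝ] ℝ :=
  ContinuousLinearMap.comp (a.2 : TangentSpace 𝓘(ℝ, E) a.1 →L[ℝ] ℝ)
    (mfderiv (cotangentModel E) 𝓘(ℝ, E)
      (fun b : CotangentBundle E Q => b.1) a)

/-- The coordinate expression of `ϑ₀` in the preferred chart about `a`, that is, its pullback by
the inverse of that chart. -/
def fundamentalFormInChart (a : CotangentBundle E Q) (y : E × (E →L[ℝ] ℝ)) :
    (E × (E →L[ℝ] ℝ)) →L[ℝ] ℝ :=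
  (fundamentalForm ((extChartAt (cotangentModel E) a).symm y)).comp
    (mfderiv 𝓘(ℝ, E × (E →L[ℝ] ℝ)) (cotangentModel E)
      (extChartAt (cotangentModel E) a).symm y)

/-- The symplectic form `ω = dϑ₀` of `T*Q` at `a`. The exterior derivative is computed in the
preferred chart about `a`: for a one-form `θ` on an open subset of a vector space,
`dθ(u, v) = (D_u θ)(v) - (D_v θ)(u)`. -/
def symplecticForm (a : CotangentBundle E Q) (u v : TangentSpace (cotangentModel E) a) : ℝ :=
  let ψ := extChartAt (cotangentModel E) a
  let Dθ := fderiv ℝ (fundamentalFormInChart a) (ψ a)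
  let T := mfderiv (cotangentModel E) 𝓘(ℝ, E × (E →L[ℝ] ℝ)) ψ a
  Dθ (T u) (T v) - Dθ (T v) (T u)

/-- `X` is the value at `a` of the Hamiltonian vector field of `f`, i.e. `X ⌟ ω = -df` at `a`. -/
def IsHamiltonianVectorAt (f : CotangentBundle E Q → ℝ) (a : CotangentBundle E Q)
    (X : TangentSpace (cotangentModel E) a) : Prop :=
  ∀ v : TangentSpace (cotangentModel E) a,
    symplecticForm a X v = -(mfderiv (cotangentModel E) 𝓘(ℝ, ℝ) f a v : ℝ)

/-- The Hamiltonian vector field `X_f`: the vector field on `T*Q` with `X_f ⌟ ω = -df`. -/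
def hamiltonianVectorField (f : CotangentBundle E Q → ℝ) (a : CotangentBundle E Q) :
    TangentSpace (cotangentModel E) a :=
  Classical.epsilon (IsHamiltonianVectorAt f a)

/-- The Poisson bracket `{f, g} = X_g f`. -/
def poissonBracket (f g : CotangentBundle E Q → ℝ) (a : CotangentBundle E Q) : ℝ :=
  mfderiv (cotangentModel E) 𝓘(ℝ, ℝ) f a (hamiltonianVectorField g a)

/-! ### Lagrangian dynamics -/

/-- The Legendre transformation `ℒ : TQ → T*Q` of the Lagrangian `l`: the derivative of `l` along
the fibres of `TQ`. -/
def legendre (l : TangentBundle 𝓘(ℝ, E) Q → ℝ) (v : TangentBundle 𝓘(ℝ, E) Q) :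
    CotangentBundle E Q :=
  ⟨v.1, fderiv ℝ (fun w : TangentSpace 𝓘(ℝ, E) v.1 => l ⟨v.1, w⟩) v.2⟩

/-- The energy `e(v) = ⟨ℒ(v), v⟩ - l(v)`. -/
def energy (l : TangentBundle 𝓘(ℝ, E) Q → ℝ) (v : TangentBundle 𝓘(ℝ, E) Q) : ℝ :=
  ((legendre l v).2 : TangentSpace 𝓘(ℝ, E) v.1 →L[ℝ] ℝ) v.2 - l v

/-- The first jet extension `j¹γ(t) = γ̇(t) ∈ TQ` of a curve `γ` in `Q`. -/
def jet (γ : ℝ → Q) (t : ℝ) : TangentBundle 𝓘(ℝ, E) Q :=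
  ⟨γ t, mfderiv 𝓘(ℝ, ℝ) 𝓘(ℝ, E) γ t (1 : ℝ)⟩

/-- The coordinate expression `l(x, ẋ)` of the Lagrangian in a chart `φ` of `Q`. -/
def lagrangianInChart (l : TangentBundle 𝓘(ℝ, E) Q → ℝ) (φ : OpenPartialHomeomorph Q E)
    (x v : E) : ℝ :=
  l ⟨φ.symm x, mfderiv 𝓘(ℝ, E) 𝓘(ℝ, E) φ.symm x v⟩

/-- The curve `γ` is a smooth solution on the set `s` of times of the Euler-Lagrange equations
`d/dt (∂l/∂ẋ) = ∂l/∂x`, in every chart of the atlas of `Q`. -/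
structure IsSolution (l : TangentBundle 𝓘(ℝ, E) Q → ℝ) (γ : ℝ → Q) (s : Set ℝ) : Prop where
  smooth : ContMDiffOn 𝓘(ℝ, ℝ) 𝓘(ℝ, E) ∞ γ s
  eulerLagrange : ∀ φ ∈ atlas E Q, ∀ t ∈ s, γ t ∈ φ.source →
    HasDerivAt
      (fun τ : ℝ => fderiv ℝ (fun v : E => lagrangianInChart l φ (φ (γ τ)) v)
        (deriv (fun σ : ℝ => φ (γ σ)) τ))
      (fderiv ℝ (fun x : E => lagrangianInChart l φ x (deriv (fun σ : ℝ => φ (γ σ)) t))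
        (φ (γ t)))
      t

/-! ### Constraints -/

/-- The primary constraint set `𝒫 = ℒ(TQ)`. -/
def primaryConstraintSet (l : TangentBundle 𝓘(ℝ, E) Q → ℝ) : Set (CotangentBundle E Q) :=
  range (legendre l)

/-- The initial data constraint `𝒟`: all `v ∈ TQ` of the form `v = j¹γ(0)` for a solution `γ` of
the Euler-Lagrange equations on some interval `(-ε, ε)`. -/
def initialDataConstraint (l : TangentBundle 𝓘(ℝ, E) Q → ℝ) : Set (TangentBundle 𝓘(ℝ, E) Q) :=
  {v | ∃ ε > (0 : ℝ), ∃ γ : ℝ → Q, IsSolution l γ (Ioo (-ε) ε) ∧ jet γ 0 = v}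

/-- The constraint set `𝒞 = ℒ(𝒟)`. -/
def constraintSet (l : TangentBundle 𝓘(ℝ, E) Q → ℝ) : Set (CotangentBundle E Q) :=
  legendre l '' initialDataConstraint l

/-- Constraint functions: smooth functions on `T*Q` vanishing on the constraint set. -/
def IsConstraintFunction (l : TangentBundle 𝓘(ℝ, E) Q → ℝ) (c : CotangentBundle E Q → ℝ) :
    Prop :=
  ContMDiff (cotangentModel E) 𝓘(ℝ, ℝ) ∞ c ∧ ∀ a ∈ constraintSet l, c a = 0

/-- First class functions: smooth functions on `T*Q` whose Poisson bracket with every constraint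
function is a constraint function. -/
def IsFirstClass (l : TangentBundle 𝓘(ℝ, E) Q → ℝ) (f : CotangentBundle E Q → ℝ) : Prop :=
  ContMDiff (cotangentModel E) 𝓘(ℝ, ℝ) ∞ f ∧
    ∀ c : CotangentBundle E Q → ℝ, IsConstraintFunction l c →
      IsConstraintFunction l (poissonBracket f c)

/-- The Legendre transformation is a submersion of `TQ` onto the submanifold `𝒫 = ℒ(TQ)`: at each
`v ∈ TQ` its derivative maps `T_v(TQ)` onto the tangent space of `𝒫` at `ℒ(v)`. -/
def LegendreIsSubmersion (l : TangentBundle 𝓘(ℝ, E) Q → ℝ) : Prop :=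
  ∀ v : TangentBundle 𝓘(ℝ, E) Q,
    range (mfderiv 𝓘(ℝ, E).tangent (cotangentModel E) (legendre l) v) =
      submanifoldTangentSpace (cotangentModel E) (primaryConstraintSet l) (legendre l v)

end DiracConstraints

end

/-!
Let `Z` be the velocity at time `t` of the curve `ℒ ∘ j¹γ`, let `a = ℒ(j¹γ(t))`, and let `𝒫` be the
range of `ℒ`. The velocity need not be the Hamiltonian vector `X_h(a)`, but
`ω(Z, w) = -dh(w)` holds for all `w` in the range of `Tℒ`, that is, for all `w ∈ T_a 𝒫`. In a
chart this is one computation: with `L(x, v)` the local Lagrangian and `G(x, v) = (x, ∂L/∂v)` the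
local Legendre transformation, differentiating `h(G(x, v)) = (∂L/∂v) v - L(x, v)` in a direction
that `DG` maps to `(k₁, k₂)` gives `dh(k₁, k₂) = k₂ v - (∂L/∂x) k₁`, the two terms
`(∂L/∂v) δv` cancelling (`fderiv_comp_fiberDerivative`). By the Euler-Lagrange equations `Z` has
the coordinates `(v, ∂L/∂x)`, so the right hand side is `-ω(Z, (k₁, k₂))`
(`symplecticForm_mfderiv_legendre`).

Hence the covector `(Z - X_h) ⌟ ω` annihilates `T_a 𝒫`. In a slice chart for `𝒫` it is a linear
form which vanishes on the slice; multiplied by a bump function it gives a smooth function `c` on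
`T*Q` with `c = 0` on `𝒫` and `dc = -(Z - X_h) ⌟ ω` at `a`
(`IsEmbeddedSubmanifold.exists_contMDiff_eq_zero`), so `X_c(a) = Z - X_h(a)` as `ω` is
nondegenerate. The constraint set lies in `𝒫`, so `c` is a constraint function. As `f` is first
class and `a` lies in the constraint set (translate `γ` in time),
`0 = {f, c}(a) = df(Z) - df(X_h) = d/dt f(ℒ j¹γ(t)) - {f, h}(a)`.
-/

namespace DiracConstraints

/-! ### Functions vanishing on an embedded submanifold -/

/-- The total space of a fibre bundle with Hausdorff base and fibre is Hausdorff: points of one fibre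
are separated inside a trivialization. For `T*Q` this is what bump functions require. -/
theorem t2Space_totalSpace {B F : Type*} {V : B → Type*} [TopologicalSpace B] [TopologicalSpace F]
    [TopologicalSpace (Bundle.TotalSpace F V)] [∀ b, TopologicalSpace (V b)] [FiberBundle F V]
    [T2Space B] [T2Space F] : T2Space (Bundle.TotalSpace F V) := by
  refine ⟨fun x y hxy => ?_⟩
  by_cases hb : x.1 = y.1
  · let e := trivializationAt F V x.1
    have hx : x ∈ e.source := FiberBundle.mem_trivializationAt_proj_source
    have hy : y ∈ e.source := by
      rw [e.mem_source, ← hb]; exact FiberBundle.mem_baseSet_trivializationAt' _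
    obtain ⟨U, U', hU, hU', hxU, hyU', hd⟩ := t2_separation (e.injOn.ne hx hy hxy)
    exact ⟨_, _, e.toOpenPartialHomeomorph.isOpen_inter_preimage hU,
      e.toOpenPartialHomeomorph.isOpen_inter_preimage hU', ⟨hx, hxU⟩, ⟨hy, hyU'⟩,
      (hd.preimage e).mono inter_subset_right inter_subset_right⟩
  · exact separated_by_continuous (FiberBundle.continuous_proj F V) hb

section SliceCharts

variable {F : Type*} [NormedAddCommGroup F] [NormedSpace ℝ F]
  {H : Type*} [TopologicalSpace H] {J : ModelWithCorners ℝ F H} [J.Boundaryless]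
  {M : Type*} [TopologicalSpace M] [ChartedSpace H M]

theorem isInvertible_mfderiv_extend {φ : OpenPartialHomeomorph M H}
    (hφ : φ ∈ IsManifold.maximalAtlas J ∞ M) {p : M} (hp : p ∈ φ.source) :
    (mfderiv J 𝓘(ℝ, F) (φ.extend J) p).IsInvertible := by
  have h1 : MDifferentiableAt J 𝓘(ℝ, F) (φ.extend J) p :=
    (φ.contMDiffAt_extend hφ hp).mdifferentiableAt (by simp)
  have ht : φ.extend J p ∈ (φ.extend J).target :=
    (φ.extend J).map_source (by rwa [φ.extend_source])
  have hopen : IsOpen (φ.extend J).target := φ.isOpen_extend_target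
  have h2 : MDifferentiableAt 𝓘(ℝ, F) J (φ.extend J).symm (φ.extend J p) :=
    ((contMDiffOn_extend_symm hφ).contMDiffAt
      (by rw [← φ.extend_target']; exact hopen.mem_nhds ht)).mdifferentiableAt (by simp)
  have hl : (φ.extend J).symm (φ.extend J p) = p := φ.extend_left_inv hp
  have e1 : (φ.extend J).symm ∘ φ.extend J =ᶠ[𝓝 p] id := by
    filter_upwards [φ.open_source.mem_nhds hp] with z hz using φ.extend_left_inv hz
  have e2 : φ.extend J ∘ (φ.extend J).symm =ᶠ[𝓝 (φ.extend J p)] id := by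
    filter_upwards [hopen.mem_nhds ht] with z hz using (φ.extend J).right_inv hz
  have h1' : MDifferentiableAt J 𝓘(ℝ, F) (φ.extend J) ((φ.extend J).symm (φ.extend J p)) := by
    rwa [hl]
  have c1 := mfderiv_comp p h2 h1
  have c2 := mfderiv_comp (φ.extend J p) h1' h2
  rw [e1.mfderiv_eq, mfderiv_id] at c1
  rw [e2.mfderiv_eq, mfderiv_id, hl] at c2
  exact ContinuousLinearMap.IsInvertible.of_inverse c2.symm c1.symm

/-- A covector at a point of an embedded submanifold `S` which annihilates the tangent space of `S`
is the differential of a global smooth function vanishing on `S`: read in a slice chart, the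
covector is a linear function which vanishes on the slice, and a bump function extends it by
zero. -/
theorem IsEmbeddedSubmanifold.exists_contMDiff_eq_zero [FiniteDimensional ℝ F] [T2Space M]
    [IsManifold J ∞ M] {S : Set M}
    (hS : IsEmbeddedSubmanifold J S) {p : M} (hp : p ∈ S) (η : TangentSpace J p →L[ℝ] ℝ)
    (hη : ∀ w ∈ submanifoldTangentSpace J S p, η w = 0) :
    ∃ c : M → ℝ, ContMDiff J 𝓘(ℝ, ℝ) ∞ c ∧ (∀ x ∈ S, c x = 0) ∧
      mfderiv J 𝓘(ℝ, ℝ) c p = η := by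
  obtain ⟨φ, W, hpφ, hφ⟩ := hS p hp
  obtain ⟨(e : TangentSpace J p ≃L[ℝ] F), he⟩ := isInvertible_mfderiv_extend hφ.mem_maximalAtlas hpφ
  let η' : F →L[ℝ] ℝ := η.comp (e.symm : F →L[ℝ] TangentSpace J p)
  have hη' : ∀ y ∈ W, η' y = 0 := by
    intro y hy
    refine hη _ ⟨φ, W, hpφ, hφ, ?_⟩
    rw [← he]
    change e (e.symm y) ∈ W
    rwa [e.apply_symm_apply]
  have hg : ContMDiffOn J 𝓘(ℝ, ℝ) ∞ (η' ∘ φ.extend J) φ.source :=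
    η'.contMDiff.comp_contMDiffOn (φ.contMDiffOn_extend hφ.mem_maximalAtlas)
  obtain ⟨ρ, -, hρ⟩ := (SmoothBumpFunction.nhds_basis_tsupport (I := J) p).mem_iff.1
    (φ.open_source.mem_nhds hpφ)
  refine ⟨fun x => ρ x * η' (φ.extend J x), ?_, ?_, ?_⟩
  · refine contMDiff_of_tsupport fun x hx => ?_
    have hx' : x ∈ φ.source := hρ (tsupport_mul_subset_left hx)
    exact ρ.contMDiffAt.mul (hg.contMDiffAt (φ.open_source.mem_nhds hx'))
  · intro x hx
    by_cases hxφ : x ∈ φ.source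
    · exact mul_eq_zero_of_right _ (hη' _ ((hφ.mem_iff x hxφ).1 hx))
    · have : ρ x = 0 := by
        by_contra hne
        exact hxφ (hρ (subset_tsupport _ hne))
      simp [this]
  · have e1 : (fun x => ρ x * η' (φ.extend J x)) =ᶠ[𝓝 p] η' ∘ φ.extend J := by
      filter_upwards [ρ.eventuallyEq_one] with x hx
      simp [hx]
    have h1 : MDifferentiableAt J 𝓘(ℝ, F) (φ.extend J) p :=
      (φ.contMDiffAt_extend hφ.mem_maximalAtlas hpφ).mdifferentiableAt (by simp)
    rw [e1.mfderiv_eq, mfderiv_comp p η'.mdifferentiableAt h1, ← he,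
      ContinuousLinearMap.mfderiv_eq]
    ext w
    exact congrArg η (e.symm_apply_apply w)

end SliceCharts

/-! ### Differentials in the preferred charts -/

theorem exists_mfderiv_extChartAt_eq {F H M : Type*} [NormedAddCommGroup F] [NormedSpace ℝ F]
    [TopologicalSpace H] {J : ModelWithCorners ℝ F H} [TopologicalSpace M] [ChartedSpace H M]
    [IsManifold J 1 M] (a : M) (X : F) :
    ∃ w : TangentSpace J a, mfderiv J 𝓘(ℝ, F) (extChartAt J a) a w = X := by
  obtain ⟨e, he⟩ := isInvertible_mfderiv_extChartAt (I := J) (mem_extChartAt_source (I := J) a)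
  exact ⟨e.symm X, by rw [← he]; exact e.apply_symm_apply X⟩

/-- The differential of a function, computed from its coordinate expression in the preferred
chart. -/
theorem mfderiv_eq_fderiv_comp_extChartAt {F H M : Type*} [NormedAddCommGroup F] [NormedSpace ℝ F]
    [TopologicalSpace H] {J : ModelWithCorners ℝ F H} [J.Boundaryless] [TopologicalSpace M]
    [ChartedSpace H M] [IsManifold J 1 M] {f : M → ℝ} {a : M} (hf : MDifferentiableAt J 𝓘(ℝ, ℝ) f a)
    (w : TangentSpace J a) :
    DifferentiableAt ℝ (f ∘ (extChartAt J a).symm) (extChartAt J a a) ∧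
    mfderiv J 𝓘(ℝ, ℝ) f a w =
      fderiv ℝ (f ∘ (extChartAt J a).symm) (extChartAt J a a)
        (mfderiv J 𝓘(ℝ, F) (extChartAt J a) a w) := by
  have hψ : MDifferentiableAt 𝓘(ℝ, F) J (extChartAt J a).symm (extChartAt J a a) :=
    ((contMDiffOn_extChartAt_symm (n := 1) a).contMDiffAt
      (extChartAt_target_mem_nhds' (mem_extChartAt_target a))).mdifferentiableAt (by simp)
  have hf' : MDifferentiableAt J 𝓘(ℝ, ℝ) f ((extChartAt J a).symm (extChartAt J a a)) := by
    rwa [extChartAt_to_inv]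
  have hF := hf'.comp _ hψ
  refine ⟨hF.differentiableAt, ?_⟩
  have h1 := mfderiv_comp a hF (mdifferentiableAt_extChartAt (mem_chart_source H a))
  have h2 : (f ∘ (extChartAt J a).symm) ∘ extChartAt J a =ᶠ[𝓝 a] f := by
    filter_upwards [extChartAt_source_mem_nhds (I := J) a] with z hz
    exact congrArg f ((extChartAt J a).left_inv hz)
  rw [h2.mfderiv_eq] at h1
  rw [h1, mfderiv_eq_fderiv]
  rfl

/-! ### Solutions of the Euler-Lagrange equations -/

variable {E : Type*} [NormedAddCommGroup E] [NormedSpace ℝ E]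
  {Q : Type*} [TopologicalSpace Q] [ChartedSpace E Q]

theorem IsSolution.eventually_mem_source {l : TangentBundle 𝓘(ℝ, E) Q → ℝ} {γ : ℝ → Q} {I : Set ℝ}
    (hγ : IsSolution l γ I) (hI : IsOpen I) {t : ℝ} (ht : t ∈ I) :
    ∀ᶠ τ in 𝓝 t, τ ∈ I ∧ γ τ ∈ (chartAt E (γ t)).source :=
  (hI.eventually_mem ht).and <|
    (hγ.smooth.contMDiffAt (hI.mem_nhds ht)).continuousAt.eventually_mem
      ((chartAt E (γ t)).open_source.mem_nhds (mem_chart_source E (γ t)))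

theorem IsSolution.mdifferentiableAt {l : TangentBundle 𝓘(ℝ, E) Q → ℝ} {γ : ℝ → Q} {I : Set ℝ}
    (hγ : IsSolution l γ I) (hI : IsOpen I) {t : ℝ} (ht : t ∈ I) :
    MDifferentiableAt 𝓘(ℝ, ℝ) 𝓘(ℝ, E) γ t :=
  (hγ.smooth.contMDiffAt (hI.mem_nhds ht)).mdifferentiableAt (by simp)

/-- Translation in time turns every jet of a solution into the jet at time `0` of a solution. -/
theorem IsSolution.jet_mem_initialDataConstraint {l : TangentBundle 𝓘(ℝ, E) Q → ℝ} {γ : ℝ → Q}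
    {I : Set ℝ} (hγ : IsSolution l γ I) (hI : IsOpen I) {t : ℝ} (ht : t ∈ I) :
    jet γ t ∈ initialDataConstraint l := by
  obtain ⟨ε, hε, hball⟩ := Metric.isOpen_iff.1 hI t ht
  have hmaps : ∀ s ∈ Ioo (-ε) ε, s + t ∈ I := fun s hs => hball (by
    rw [Metric.mem_ball, Real.dist_eq, add_sub_cancel_right]; exact abs_lt.2 hs)
  refine ⟨ε, hε, fun s => γ (s + t), ⟨?_, ?_⟩, ?_⟩
  · refine hγ.smooth.comp (t := I) (ContDiff.contMDiff (by fun_prop)).contMDiffOn hmaps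
  · intro φ hφ s hs hsφ
    have h := hγ.eulerLagrange φ hφ (s + t) (hmaps s hs) hsφ
    have h2 := h.comp_add_const s t
    simp only [deriv_comp_add_const (fun σ => φ (γ σ)) t]
    exact h2
  · have hm : MDifferentiableAt 𝓘(ℝ, ℝ) 𝓘(ℝ, E) γ (0 + t) := by
      rw [zero_add]; exact hγ.mdifferentiableAt hI ht
    have hc : HasMFDerivAt 𝓘(ℝ, ℝ) 𝓘(ℝ, ℝ) (fun s : ℝ => s + t) 0 (ContinuousLinearMap.id ℝ ℝ) :=
      ((hasFDerivAt_id (0 : ℝ)).add_const t).hasMFDerivAt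
    have h := (hm.hasMFDerivAt.comp (0 : ℝ) hc).mfderiv
    have h1 : jet (fun s => γ (s + t)) 0 = (jet γ (0 + t) : TangentBundle 𝓘(ℝ, E) Q) :=
      congrArg (fun A : ℝ →L[ℝ] E => (⟨γ (0 + t), A 1⟩ : TangentBundle 𝓘(ℝ, E) Q)) h
    rw [h1, zero_add]

/-! ### The symplectic form in the preferred charts of the cotangent bundle -/

variable [IsManifold 𝓘(ℝ, E) ∞ Q]

/-- The preferred chart of `T*Q` about `a` sends a covector `b` at `q` to the coordinates of `q`
together with the pullback of `b` by the inverse of the chart of `Q`. -/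
theorem cotangent_extChartAt_apply (a b : CotangentBundle E Q) (hb : b.1 ∈ (chartAt E a.1).source) :
    extChartAt (cotangentModel E) a b = (chartAt E a.1 b.1,
      (b.2 : TangentSpace 𝓘(ℝ, E) b.1 →L[ℝ] ℝ).comp
       (mfderiv 𝓘(ℝ, E) 𝓘(ℝ, E) (chartAt E a.1).symm (chartAt E a.1 b.1))) := by
  have := TangentBundle.symmL_trivializationAt (I := 𝓘(ℝ, E)) hb
  simp only [extChartAt, OpenPartialHomeomorph.extend, mfld_simps, mfderivWithin_univ] at this
  simp only [extChartAt, OpenPartialHomeomorph.extend, PartialEquiv.coe_trans, Function.comp,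
    OpenPartialHomeomorph.toFun_eq_coe, ModelWithCorners.toPartialEquiv_coe, hom_chart]
  ext1
  · rfl
  simp only [modelWithCorners_prod_coe, modelWithCornersSelf_coe, Prod.map_apply, id_eq,
    ContinuousLinearMap.inCoordinates, this, Bundle.Trivial.fiberBundle_trivializationAt',
    Bundle.Trivial.continuousLinearMapAt_trivialization, ContinuousLinearMap.id_comp]
  rfl

theorem cotangent_extChartAt_target (a : CotangentBundle E Q) :
    (extChartAt (cotangentModel E) a).target = (chartAt E a.1).target ×ˢ univ := by
  rw [FiberBundle.extChartAt_target]
  congr 1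
  simp only [hom_trivializationAt_baseSet, TangentBundle.trivializationAt_baseSet,
    Bundle.Trivial.fiberBundle_trivializationAt', Bundle.Trivial.trivialization_baseSet,
    inter_univ, mfld_simps]
  exact inter_eq_left.2 fun x hx => (chartAt E a.1).map_target hx

theorem cotangent_extChartAt_source (a : CotangentBundle E Q) :
    (extChartAt (cotangentModel E) a).source = {b | b.1 ∈ (chartAt E a.1).source} := by
  ext b
  rw [extChartAt_source, FiberBundle.chartedSpace_chartAt]
  simp only [hom_trivializationAt_source, TangentBundle.trivializationAt_baseSet,
    Bundle.Trivial.fiberBundle_trivializationAt', Bundle.Trivial.trivialization_baseSet,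
    inter_univ, mfld_simps]
  constructor
  · exact fun h => h.1
  · exact fun h => ⟨h, h⟩

theorem cotangent_extChartAt_symm_proj (a : CotangentBundle E Q) {y : E × (E →L[ℝ] ℝ)}
    (hy : y.1 ∈ (chartAt E a.1).target) :
    ((extChartAt (cotangentModel E) a).symm y).1 = (chartAt E a.1).symm y.1 := by
  refine FiberBundle.chartedSpace_chartAt_symm_fst (HB := E) a y ?_
  have : y ∈ (extChartAt (cotangentModel E) a).target := by
    rw [cotangent_extChartAt_target]; exact ⟨hy, trivial⟩
  rw [extChartAt, OpenPartialHomeomorph.extend_target] at this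
  exact this.1

/-- In the coordinates `(x, p)` of a preferred chart, `ϑ₀ = p dx`. -/
theorem fundamentalFormInChart_apply (a : CotangentBundle E Q) {y : E × (E →L[ℝ] ℝ)}
    (hy : y.1 ∈ (chartAt E a.1).target) :
    fundamentalFormInChart a y = y.2.comp (ContinuousLinearMap.fst ℝ E (E →L[ℝ] ℝ)) := by
  have hyt : y ∈ (extChartAt (cotangentModel E) a).target := by
    rw [cotangent_extChartAt_target]; exact ⟨hy, trivial⟩
  have hb := cotangent_extChartAt_symm_proj a hy
  set b := (extChartAt (cotangentModel E) a).symm y with hbdef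
  have hbs : b.1 ∈ (chartAt E a.1).source := by
    rw [hb]; exact (chartAt E a.1).map_target hy
  have h2 := cotangent_extChartAt_apply a b hbs
  rw [hbdef, (extChartAt (cotangentModel E) a).right_inv hyt, ← hbdef, hb,
    (chartAt E a.1).right_inv hy] at h2
  have hψ : MDifferentiableAt 𝓘(ℝ, E × (E →L[ℝ] ℝ)) (cotangentModel E)
      (extChartAt (cotangentModel E) a).symm y :=
    ((contMDiffOn_extChartAt_symm (n := ∞) a).contMDiffAt
      (extChartAt_target_mem_nhds' hyt)).mdifferentiableAt (by simp)
  have hπ : MDifferentiableAt (cotangentModel E) 𝓘(ℝ, E) (fun b : CotangentBundle E Q => b.1) b :=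
    (Bundle.contMDiffAt_proj (n := ∞) _).mdifferentiableAt (by simp)
  have hs : MDifferentiableAt 𝓘(ℝ, E) 𝓘(ℝ, E) (chartAt E a.1).symm y.1 :=
    mdifferentiableAt_atlas_symm (chart_mem_atlas _ _) hy
  have hfst : HasMFDerivAt 𝓘(ℝ, E × (E →L[ℝ] ℝ)) 𝓘(ℝ, E) (Prod.fst : E × (E →L[ℝ] ℝ) → E) y
      (ContinuousLinearMap.fst ℝ E (E →L[ℝ] ℝ)) := hasFDerivAt_fst.hasMFDerivAt
  -- The inverse of the chart covers the inverse of the chart of `Q`, and `y.2` is the pullback of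
  -- the covector `b.2` by the latter.
  have e1 := mfderiv_comp y hπ hψ
  have e2 := (hs.hasMFDerivAt.comp y hfst)
  have e3 : (fun b : CotangentBundle E Q => b.1) ∘ (extChartAt (cotangentModel E) a).symm
      =ᶠ[𝓝 y] (chartAt E a.1).symm ∘ Prod.fst := by
    filter_upwards [continuous_fst.continuousAt.preimage_mem_nhds
      ((chartAt E a.1).open_target.mem_nhds hy)] with z hz
    exact cotangent_extChartAt_symm_proj a hz
  rw [e3.mfderiv_eq, e2.mfderiv] at e1
  have h22 := congrArg Prod.snd h2
  refine ContinuousLinearMap.ext fun u => ?_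
  have e4 := congrArg (fun A => (b.2 : TangentSpace 𝓘(ℝ, E) b.1 →L[ℝ] ℝ) (A u)) e1
  have e5 := congrArg (fun A : E →L[ℝ] ℝ => A u.1) h22
  exact e4.symm.trans e5.symm

/-- In the coordinates `(x, p)` of the preferred chart, `ω = dp ∧ dx`. -/
theorem symplecticForm_apply (a : CotangentBundle E Q)
    (u v : TangentSpace (cotangentModel E) a) :
    symplecticForm a u v =
      let T := mfderiv (cotangentModel E) 𝓘(ℝ, E × (E →L[ℝ] ℝ)) (extChartAt (cotangentModel E) a) a
      (T u : E × (E →L[ℝ] ℝ)).2 (T v : E × (E →L[ℝ] ℝ)).1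
        - (T v : E × (E →L[ℝ] ℝ)).2 (T u : E × (E →L[ℝ] ℝ)).1 := by
  have hD : HasFDerivAt (fundamentalFormInChart a)
      (((ContinuousLinearMap.compL ℝ (E × (E →L[ℝ] ℝ)) E ℝ).flip
        (ContinuousLinearMap.fst ℝ E (E →L[ℝ] ℝ))).comp (ContinuousLinearMap.snd ℝ E (E →L[ℝ] ℝ)))
      (extChartAt (cotangentModel E) a a) := by
    refine (ContinuousLinearMap.hasFDerivAt _).congr_of_eventuallyEq ?_
    have : (extChartAt (cotangentModel E) a a).1 ∈ (chartAt E a.1).target := by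
      have := mem_extChartAt_target (I := cotangentModel E) a
      rw [cotangent_extChartAt_target] at this
      exact this.1
    filter_upwards [continuous_fst.continuousAt.preimage_mem_nhds
      ((chartAt E a.1).open_target.mem_nhds this)] with z hz
    exact fundamentalFormInChart_apply a hz
  simp only [symplecticForm, hD.fderiv]
  rfl

/-! ### Hamiltonian vectors -/

theorem symplecticForm_sub_left (a : CotangentBundle E Q)
    (u u' v : TangentSpace (cotangentModel E) a) :
    symplecticForm a (u - u') v = symplecticForm a u v - symplecticForm a u' v := by
  let T : TangentSpace (cotangentModel E) a →L[ℝ] E × (E →L[ℝ] ℝ) :=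
    mfderiv (cotangentModel E) 𝓘(ℝ, E × (E →L[ℝ] ℝ)) (extChartAt (cotangentModel E) a) a
  let D := fderiv ℝ (fundamentalFormInChart a) (extChartAt (cotangentModel E) a a)
  change D (T (u - u')) (T v) - D (T v) (T (u - u')) =
    (D (T u) (T v) - D (T v) (T u)) - (D (T u') (T v) - D (T v) (T u'))
  rw [map_sub, map_sub, map_sub, sub_apply, sub_sub_sub_comm]

theorem exists_continuousLinearMap_eq_symplecticForm (a : CotangentBundle E Q)
    (u : TangentSpace (cotangentModel E) a) :
    ∃ η : TangentSpace (cotangentModel E) a →L[ℝ] ℝ, ∀ v, η v = symplecticForm a u v := by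
  let T : TangentSpace (cotangentModel E) a →L[ℝ] E × (E →L[ℝ] ℝ) :=
    mfderiv (cotangentModel E) 𝓘(ℝ, E × (E →L[ℝ] ℝ)) (extChartAt (cotangentModel E) a) a
  refine ⟨((T u).2.comp (ContinuousLinearMap.fst ℝ E (E →L[ℝ] ℝ)) -
    (ContinuousLinearMap.apply ℝ ℝ (T u).1).comp
      (ContinuousLinearMap.snd ℝ E (E →L[ℝ] ℝ))).comp T, fun v => ?_⟩
  rw [symplecticForm_apply]
  rfl

/-- Nondegeneracy of `ω`: a function has at most one Hamiltonian vector at each point. -/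
theorem IsHamiltonianVectorAt.eq {f : CotangentBundle E Q → ℝ}
    {a : CotangentBundle E Q} {X Y : TangentSpace (cotangentModel E) a}
    (hX : IsHamiltonianVectorAt f a X) (hY : IsHamiltonianVectorAt f a Y) : X = Y := by
  have key : ∀ v, symplecticForm a X v = symplecticForm a Y v := fun v => (hX v).trans (hY v).symm
  obtain ⟨(e : TangentSpace (cotangentModel E) a ≃L[ℝ] E × (E →L[ℝ] ℝ)), he⟩ :=
    isInvertible_mfderiv_extChartAt (I := cotangentModel E)
    (mem_extChartAt_source (I := cotangentModel E) a)
  refine e.injective ?_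
  have key2 : ∀ k : E × (E →L[ℝ] ℝ),
      (e X : E × (E →L[ℝ] ℝ)).2 k.1 - k.2 (e X : E × (E →L[ℝ] ℝ)).1 =
      (e Y : E × (E →L[ℝ] ℝ)).2 k.1 - k.2 (e Y : E × (E →L[ℝ] ℝ)).1 := by
    intro k
    have := key (e.symm k)
    simp only [symplecticForm_apply, ← he] at this
    have h2 : e (e.symm k) = k := e.apply_symm_apply k
    change (e X : E × (E →L[ℝ] ℝ)).2 (e (e.symm k) : E × (E →L[ℝ] ℝ)).1
      - (e (e.symm k) : E × (E →L[ℝ] ℝ)).2 (e X : E × (E →L[ℝ] ℝ)).1 =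
      (e Y : E × (E →L[ℝ] ℝ)).2 (e (e.symm k) : E × (E →L[ℝ] ℝ)).1
      - (e (e.symm k) : E × (E →L[ℝ] ℝ)).2 (e Y : E × (E →L[ℝ] ℝ)).1 at this
    rwa [h2] at this
  refine Prod.ext ?_ ?_
  · refine (SeparatingDual.eq_iff_forall_dual_eq (R := ℝ)).2 fun g => ?_
    simpa using key2 (0, g)
  · refine ContinuousLinearMap.ext fun x => ?_
    simpa using key2 (x, 0)

/-- Hamilton's equations `X = (∂f/∂p, -∂f/∂x)`, where finite-dimensionality identifies `∂f/∂p ∈ E**`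
with a vector of `E`. -/
theorem exists_isHamiltonianVectorAt [FiniteDimensional ℝ E] (f : CotangentBundle E Q → ℝ)
    (a : CotangentBundle E Q) : ∃ X, IsHamiltonianVectorAt f a X := by
  obtain ⟨(e : TangentSpace (cotangentModel E) a ≃L[ℝ] E × (E →L[ℝ] ℝ)), he⟩ :=
    isInvertible_mfderiv_extChartAt (I := cotangentModel E)
    (mem_extChartAt_source (I := cotangentModel E) a)
  let β : (E × (E →L[ℝ] ℝ)) →L[ℝ] ℝ :=
    (mfderiv (cotangentModel E) 𝓘(ℝ, ℝ) f a).comp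
      (e.symm : (E × (E →L[ℝ] ℝ)) →L[ℝ] TangentSpace (cotangentModel E) a)
  -- `E` is reflexive, so the restriction of `df` to the fibre directions is evaluation at some `x`.
  let x : E := (Module.evalEquiv ℝ E).symm
    ((β.comp (ContinuousLinearMap.inr ℝ E (E →L[ℝ] ℝ))).toLinearMap ∘ₗ
      (LinearMap.toContinuousLinearMap (𝕜 := ℝ) (E := E) (F' := ℝ)).toLinearMap)
  have hx : ∀ g : E →L[ℝ] ℝ, g x = β (0, g) := by
    intro g
    have := Module.apply_evalEquiv_symm_apply (R := ℝ) (M := E) g.toLinearMap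
      ((β.comp (ContinuousLinearMap.inr ℝ E (E →L[ℝ] ℝ))).toLinearMap ∘ₗ
      (LinearMap.toContinuousLinearMap (𝕜 := ℝ) (E := E) (F' := ℝ)).toLinearMap)
    exact this
  let p : E →L[ℝ] ℝ := -β.comp (ContinuousLinearMap.inl ℝ E (E →L[ℝ] ℝ))
  refine ⟨e.symm (x, p), fun v => ?_⟩
  rw [symplecticForm_apply, ← he]
  have h2 : e (e.symm (x, p)) = (x, p) := e.apply_symm_apply _
  change (e (e.symm (x, p)) : E × (E →L[ℝ] ℝ)).2 (e v : E × (E →L[ℝ] ℝ)).1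
      - (e v : E × (E →L[ℝ] ℝ)).2 (e (e.symm (x, p)) : E × (E →L[ℝ] ℝ)).1 = _
  rw [h2]
  dsimp only
  rw [hx]
  have h3 : (mfderiv (cotangentModel E) 𝓘(ℝ, ℝ) f a v : ℝ) = β (e v) := by
    change _ = mfderiv (cotangentModel E) 𝓘(ℝ, ℝ) f a (e.symm (e v))
    rw [e.symm_apply_apply]
  rw [h3]
  have h4 : (e v : E × (E →L[ℝ] ℝ)) =
      ((e v : E × (E →L[ℝ] ℝ)).1, 0) + (0, (e v : E × (E →L[ℝ] ℝ)).2) := by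
    simp
  have h5 := congrArg β h4
  rw [map_add] at h5
  rw [h5]
  change -β ((e v : E × (E →L[ℝ] ℝ)).1, 0) - _ = _
  exact (neg_add' _ _).symm

theorem IsHamiltonianVectorAt.poissonBracket_eq
    {g : CotangentBundle E Q → ℝ} {a : CotangentBundle E Q}
    {X : TangentSpace (cotangentModel E) a} (hX : IsHamiltonianVectorAt g a X)
    (f : CotangentBundle E Q → ℝ) :
    poissonBracket f g a = mfderiv (cotangentModel E) 𝓘(ℝ, ℝ) f a X := by
  have h : IsHamiltonianVectorAt g a (hamiltonianVectorField g a) := Classical.epsilon_spec ⟨X, hX⟩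
  rw [poissonBracket, h.eq hX]

/-! ### The Lagrangian and the Legendre transformation in charts -/

theorem tangent_extChartAt_symm_apply (w : TangentBundle 𝓘(ℝ, E) Q) {y : E × E}
    (hy : y.1 ∈ (chartAt E w.1).target) :
    (extChartAt 𝓘(ℝ, E).tangent w).symm y = ⟨(chartAt E w.1).symm y.1,
      mfderiv 𝓘(ℝ, E) 𝓘(ℝ, E) (chartAt E w.1).symm y.1 y.2⟩ :=
  (tangentMap_chart_symm (I := 𝓘(ℝ, E)) (p := w) (q := ⟨y.1, y.2⟩) hy).symm

theorem tangent_extChartAt_target (w : TangentBundle 𝓘(ℝ, E) Q) :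
    (extChartAt 𝓘(ℝ, E).tangent w).target = (chartAt E w.1).target ×ˢ univ := by
  ext y
  have := TangentBundle.mem_chart_target_iff (I := 𝓘(ℝ, E)) y w
  rw [extChartAt, OpenPartialHomeomorph.extend_target]
  refine ⟨fun h => ⟨this.1 h.1, trivial⟩, fun h => ⟨this.2 h.1, ?_⟩⟩
  rw [ModelWithCorners.range_eq_univ]
  trivial

theorem lagrangianInChart_eq (l : TangentBundle 𝓘(ℝ, E) Q → ℝ) (w : TangentBundle 𝓘(ℝ, E) Q)
    {y : E × E} (hy : y.1 ∈ (chartAt E w.1).target) :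
    lagrangianInChart l (chartAt E w.1) y.1 y.2 = l ((extChartAt 𝓘(ℝ, E).tangent w).symm y) := by
  rw [tangent_extChartAt_symm_apply w hy]
  rfl

theorem contDiffOn_lagrangianInChart {l : TangentBundle 𝓘(ℝ, E) Q → ℝ}
    (hl : ContMDiff 𝓘(ℝ, E).tangent 𝓘(ℝ, ℝ) ∞ l) (q : Q) :
    ContDiffOn ℝ ∞ (fun y : E × E => lagrangianInChart l (chartAt E q) y.1 y.2)
      ((chartAt E q).target ×ˢ univ) := by
  let w : TangentBundle 𝓘(ℝ, E) Q := ⟨q, 0⟩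
  have h := hl.comp_contMDiffOn (contMDiffOn_extChartAt_symm (I := 𝓘(ℝ, E).tangent) (n := ∞) w)
  rw [tangent_extChartAt_target] at h
  exact (contMDiffOn_iff_contDiffOn.1 h).congr fun y hy => lagrangianInChart_eq l w hy.1

theorem isInvertible_mfderiv_chartAt_symm (q : Q) {x : E} (hx : x ∈ (chartAt E q).target) :
    (mfderiv 𝓘(ℝ, E) 𝓘(ℝ, E) (chartAt E q).symm x).IsInvertible := by
  have := isInvertible_mfderivWithin_extChartAt_symm (I := 𝓘(ℝ, E)) (x := q) (y := x)
    (by simpa [extChartAt, OpenPartialHomeomorph.extend] using hx)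
  rwa [modelWithCornersSelf_coe, range_id, mfderivWithin_univ] at this

/-- The fibre derivative of the local Lagrangian is the pullback, by the inverse of the chart, of
the covector `ℒ(v)`. -/
theorem fderiv_lagrangianInChart (l : TangentBundle 𝓘(ℝ, E) Q → ℝ) (q : Q)
    {x : E} (hx : x ∈ (chartAt E q).target) (v : E) :
    fderiv ℝ (fun v => lagrangianInChart l (chartAt E q) x v) v =
      ((legendre l ⟨(chartAt E q).symm x,
        mfderiv 𝓘(ℝ, E) 𝓘(ℝ, E) (chartAt E q).symm x v⟩).2 :
          TangentSpace 𝓘(ℝ, E) ((chartAt E q).symm x) →L[ℝ] ℝ).comp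
        (mfderiv 𝓘(ℝ, E) 𝓘(ℝ, E) (chartAt E q).symm x) := by
  obtain ⟨e, he⟩ := isInvertible_mfderiv_chartAt_symm q hx
  simp only [legendre, lagrangianInChart]
  rw [← he]
  exact ContinuousLinearEquiv.comp_right_fderiv (E := E) (F := E) e
    (f := fun w : E => l ⟨(chartAt E q).symm x, w⟩) (x := v)

theorem energy_eq_lagrangianInChart (l : TangentBundle 𝓘(ℝ, E) Q → ℝ) (q : Q)
    {x : E} (hx : x ∈ (chartAt E q).target) (v : E) :
    energy l ⟨(chartAt E q).symm x, mfderiv 𝓘(ℝ, E) 𝓘(ℝ, E) (chartAt E q).symm x v⟩ =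
      fderiv ℝ (fun v => lagrangianInChart l (chartAt E q) x v) v v
        - lagrangianInChart l (chartAt E q) x v := by
  rw [fderiv_lagrangianInChart l q hx]
  rfl

/-- The Legendre transformation `(x, v) ↦ (x, ∂L/∂v (x, v))` of the coordinate expression `L` of the
Lagrangian in the preferred chart of `Q` about `q`. -/
noncomputable def legendreInChart (l : TangentBundle 𝓘(ℝ, E) Q → ℝ) (q : Q) (y : E × E) :
    E × (E →L[ℝ] ℝ) :=
  (y.1, fderiv ℝ (fun v => lagrangianInChart l (chartAt E q) y.1 v) y.2)

theorem extChartAt_legendre_extChartAt_symm (l : TangentBundle 𝓘(ℝ, E) Q → ℝ)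
    (w : TangentBundle 𝓘(ℝ, E) Q) {y : E × E} (hy : y.1 ∈ (chartAt E w.1).target) :
    extChartAt (cotangentModel E) (legendre l w)
        (legendre l ((extChartAt 𝓘(ℝ, E).tangent w).symm y)) =
      legendreInChart l w.1 y := by
  rw [tangent_extChartAt_symm_apply w hy, cotangent_extChartAt_apply]
  swap
  · exact (chartAt E w.1).map_target hy
  have hr := (chartAt E w.1).right_inv hy
  refine Prod.ext hr ?_
  have hr' : chartAt E (legendre l w).1 (legendre l ⟨(chartAt E w.1).symm y.1,
      mfderiv 𝓘(ℝ, E) 𝓘(ℝ, E) (chartAt E w.1).symm y.1 y.2⟩).1 = y.1 := hr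
  simp only [legendreInChart]
  rw [fderiv_lagrangianInChart l w.1 hy, hr']
  rfl

/-- In charts of `TQ` and `T*Q` over the same chart of `Q`, `ℒ` is `legendreInChart`. -/
theorem extChartAt_legendre (l : TangentBundle 𝓘(ℝ, E) Q → ℝ)
    {w u : TangentBundle 𝓘(ℝ, E) Q} (hu : u.1 ∈ (chartAt E w.1).source) :
    extChartAt (cotangentModel E) (legendre l w) (legendre l u) =
      legendreInChart l w.1 (extChartAt 𝓘(ℝ, E).tangent w u) := by
  have hs : u ∈ (extChartAt 𝓘(ℝ, E).tangent w).source := by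
    rw [extChartAt_source]; exact (TangentBundle.mem_chart_source_iff _ _).2 hu
  have ht := (extChartAt 𝓘(ℝ, E).tangent w).map_source hs
  rw [tangent_extChartAt_target] at ht
  rw [← extChartAt_legendre_extChartAt_symm l w ht.1, (extChartAt 𝓘(ℝ, E).tangent w).left_inv hs]

theorem contDiffAt_legendreInChart {l : TangentBundle 𝓘(ℝ, E) Q → ℝ}
    (hl : ContMDiff 𝓘(ℝ, E).tangent 𝓘(ℝ, ℝ) ∞ l) (q : Q) {y : E × E}
    (hy : y.1 ∈ (chartAt E q).target) : ContDiffAt ℝ ∞ (legendreInChart l q) y := by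
  refine contDiffAt_fst.prodMk ?_
  refine ContDiffAt.fderiv (n := ∞)
    (f := fun (y : E × E) (v : E) => lagrangianInChart l (chartAt E q) y.1 v)
    (g := fun y : E × E => y.2) (m := ∞) (x₀ := y) ?_ contDiffAt_snd (by simp)
  have h := (contDiffOn_lagrangianInChart hl q).contDiffAt (x := y)
    (((chartAt E q).open_target.prod isOpen_univ).mem_nhds ⟨hy, trivial⟩)
  exact ContDiffAt.comp (g := fun y : E × E => lagrangianInChart l (chartAt E q) y.1 y.2)
    (f := fun p : (E × E) × E => (p.1.1, p.2)) (y, y.2) h (by fun_prop)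

theorem mfderiv_extChartAt_mfderiv_legendre {l : TangentBundle 𝓘(ℝ, E) Q → ℝ}
    (hl : ContMDiff 𝓘(ℝ, E).tangent 𝓘(ℝ, ℝ) ∞ l) (w : TangentBundle 𝓘(ℝ, E) Q)
    (ξ : TangentSpace 𝓘(ℝ, E).tangent w) :
    mfderiv (cotangentModel E) 𝓘(ℝ, E × (E →L[ℝ] ℝ))
        (extChartAt (cotangentModel E) (legendre l w)) (legendre l w)
        (mfderiv 𝓘(ℝ, E).tangent (cotangentModel E) (legendre l) w ξ) =
      fderiv ℝ (legendreInChart l w.1) (extChartAt 𝓘(ℝ, E).tangent w w)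
        (mfderiv 𝓘(ℝ, E).tangent 𝓘(ℝ, E × E) (extChartAt 𝓘(ℝ, E).tangent w) w ξ) := by
  have hw : ∀ᶠ u in 𝓝 w, u.1 ∈ (chartAt E w.1).source :=
    (FiberBundle.continuous_proj E (TangentSpace 𝓘(ℝ, E) (M := Q))).continuousAt.eventually_mem
      ((chartAt E w.1).open_source.mem_nhds (mem_chart_source E w.1))
  have ht := mem_extChartAt_target (I := 𝓘(ℝ, E).tangent) w
  rw [tangent_extChartAt_target] at ht
  have hG : MDifferentiableAt 𝓘(ℝ, E × E) 𝓘(ℝ, E × (E →L[ℝ] ℝ)) (legendreInChart l w.1)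
      (extChartAt 𝓘(ℝ, E).tangent w w) :=
    ((contDiffAt_legendreInChart hl w.1 ht.1).differentiableAt (by simp)).mdifferentiableAt
  have hχ : MDifferentiableAt 𝓘(ℝ, E).tangent 𝓘(ℝ, E × E) (extChartAt 𝓘(ℝ, E).tangent w) w :=
    mdifferentiableAt_extChartAt (mem_chart_source _ w)
  have hψ : MDifferentiableAt (cotangentModel E) 𝓘(ℝ, E × (E →L[ℝ] ℝ))
      (extChartAt (cotangentModel E) (legendre l w)) (legendre l w) :=
    mdifferentiableAt_extChartAt (mem_chart_source _ _)
  have hψs : MDifferentiableAt 𝓘(ℝ, E × (E →L[ℝ] ℝ)) (cotangentModel E)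
      (extChartAt (cotangentModel E) (legendre l w)).symm
      (legendreInChart l w.1 (extChartAt 𝓘(ℝ, E).tangent w w)) := by
    rw [← extChartAt_legendre l (mem_chart_source E w.1)]
    exact ((contMDiffOn_extChartAt_symm (n := 1) (legendre l w)).contMDiffAt
      (extChartAt_target_mem_nhds' (mem_extChartAt_target _))).mdifferentiableAt (by simp)
  have hleg : MDifferentiableAt 𝓘(ℝ, E).tangent (cotangentModel E) (legendre l) w := by
    refine (hψs.comp w (hG.comp w hχ)).congr_of_eventuallyEq ?_
    filter_upwards [hw] with u hu
    simp only [Function.comp_apply]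
    rw [← extChartAt_legendre l hu, (extChartAt (cotangentModel E) (legendre l w)).left_inv]
    rw [cotangent_extChartAt_source]
    exact hu
  have e : extChartAt (cotangentModel E) (legendre l w) ∘ legendre l =ᶠ[𝓝 w]
      legendreInChart l w.1 ∘ extChartAt 𝓘(ℝ, E).tangent w :=
    hw.mono fun u hu => extChartAt_legendre l hu
  have e1 := mfderiv_comp w hψ hleg
  rw [e.mfderiv_eq, mfderiv_comp w hG hχ, mfderiv_eq_fderiv] at e1
  exact (congrArg (fun A => A ξ) e1).symm

/-! ### The energy identity -/

/-- The energy identity in a vector space. Let `G(x, v) = (x, ∂L/∂v)` and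
`H(G(x, v)) = (∂L/∂v) v - L`. Then `dH(k₁, k₂) = k₂ v - (∂L/∂x) k₁` for all `(k₁, k₂)` in the range
of `DG`, whether or not `DG` is invertible. -/
theorem fderiv_comp_fiberDerivative {E : Type*} [NormedAddCommGroup E] [NormedSpace ℝ E]
    {L : E × E → ℝ} {H : E × (E →L[ℝ] ℝ) → ℝ} {G : E × E → E × (E →L[ℝ] ℝ)} {z : E × E}
    (hL : DifferentiableAt ℝ L z) (hG : DifferentiableAt ℝ G z) (hH : DifferentiableAt ℝ H (G z))
    (hGL : ∀ᶠ y in 𝓝 z, G y = (y.1, fderiv ℝ (fun v => L (y.1, v)) y.2))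
    (hE : ∀ᶠ y in 𝓝 z, H (G y) = (G y).2 y.2 - L y) (k : E × E) :
    fderiv ℝ H (G z) (fderiv ℝ G z k) =
      (fderiv ℝ G z k).2 z.2
        - fderiv ℝ (fun x => L (x, z.2)) z.1 (fderiv ℝ G z k).1 := by
  -- The base component of `G` is that of its argument.
  have h1 : (fderiv ℝ G z k).1 = k.1 := by
    have a1 : HasFDerivAt (fun y => (G y).1)
        ((ContinuousLinearMap.fst ℝ E (E →L[ℝ] ℝ)).comp (fderiv ℝ G z)) z :=
      hG.hasFDerivAt.fst
    have a2 : HasFDerivAt (fun y => (G y).1) (ContinuousLinearMap.fst ℝ E E) z :=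
      hasFDerivAt_fst.congr_of_eventuallyEq (hGL.mono fun y hy => by simp [hy])
    exact congrArg (fun A => A k) (a1.unique a2)
  have a1 := hH.hasFDerivAt.comp z hG.hasFDerivAt
  have a2 : HasFDerivAt (H ∘ G) _ z :=
    ((hG.hasFDerivAt.snd.clm_apply hasFDerivAt_snd).sub hL.hasFDerivAt).congr_of_eventuallyEq hE
  have a3 := congrArg (fun A => A k) (a1.unique a2)
  have p1 : fderiv ℝ (fun x => L (x, z.2)) z.1 k.1 = fderiv ℝ L z (k.1, 0) := by
    have := HasFDerivAt.comp (g := L) (f := fun x => (x, z.2)) z.1 hL.hasFDerivAt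
      (hasFDerivAt_prodMk_left z.1 z.2)
    have t := this.fderiv
    exact congrArg (fun A => A k.1) t
  have p2 : (G z).2 k.2 = fderiv ℝ L z (0, k.2) := by
    have := HasFDerivAt.comp (g := L) (f := fun v => (z.1, v)) z.2 hL.hasFDerivAt
      (hasFDerivAt_prodMk_right z.1 z.2)
    have t := this.fderiv
    rw [hGL.self_of_nhds]
    exact congrArg (fun A => A k.2) t
  have p3 : fderiv ℝ L z k = fderiv ℝ L z (k.1, 0) + fderiv ℝ L z (0, k.2) := by
    rw [← map_add]; simp
  rw [h1, p1]
  simp only [ContinuousLinearMap.comp_apply, sub_apply, add_apply, ContinuousLinearMap.flip_apply,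
    ContinuousLinearMap.coe_snd'] at a3
  rw [a3, p2, p3]
  ring

theorem legendreInChart_energy {l : TangentBundle 𝓘(ℝ, E) Q → ℝ} {h : CotangentBundle E Q → ℝ}
    (he : ∀ v, h (legendre l v) = energy l v) (w : TangentBundle 𝓘(ℝ, E) Q) {y : E × E}
    (hy : y.1 ∈ (chartAt E w.1).target) :
    h ((extChartAt (cotangentModel E) (legendre l w)).symm (legendreInChart l w.1 y)) =
      (legendreInChart l w.1 y).2 y.2 - lagrangianInChart l (chartAt E w.1) y.1 y.2 := by
  rw [← extChartAt_legendre_extChartAt_symm l w hy,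
    (extChartAt (cotangentModel E) (legendre l w)).left_inv, he,
    extChartAt_legendre_extChartAt_symm l w hy, tangent_extChartAt_symm_apply w hy,
    energy_eq_lagrangianInChart l w.1 hy]
  · rfl
  · rw [cotangent_extChartAt_source, tangent_extChartAt_symm_apply w hy]
    exact (chartAt E w.1).map_target hy

/-- Hamilton's equations hold tangentially to the primary constraint set: a vector `Z` at `ℒ(w)`
with coordinates `(v, ∂L/∂x)`, where `v` is the velocity coordinate of `w`, satisfies
`ω(Z, k) = -dh(k)` for all `k` in the range of the differential of `ℒ`. -/
theorem symplecticForm_mfderiv_legendre {l : TangentBundle 𝓘(ℝ, E) Q → ℝ}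
    (hl : ContMDiff 𝓘(ℝ, E).tangent 𝓘(ℝ, ℝ) ∞ l) {h : CotangentBundle E Q → ℝ}
    (hh : ContMDiff (cotangentModel E) 𝓘(ℝ, ℝ) ∞ h)
    (he : ∀ v, h (legendre l v) = energy l v) (w : TangentBundle 𝓘(ℝ, E) Q)
    {Z : TangentSpace (cotangentModel E) (legendre l w)}
    (hZ : mfderiv (cotangentModel E) 𝓘(ℝ, E × (E →L[ℝ] ℝ))
        (extChartAt (cotangentModel E) (legendre l w)) (legendre l w) Z =
      ((extChartAt 𝓘(ℝ, E).tangent w w).2,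
        fderiv ℝ (fun x => lagrangianInChart l (chartAt E w.1) x
          (extChartAt 𝓘(ℝ, E).tangent w w).2) (extChartAt 𝓘(ℝ, E).tangent w w).1))
    (ξ : TangentSpace 𝓘(ℝ, E).tangent w) :
    symplecticForm (legendre l w) Z
        (mfderiv 𝓘(ℝ, E).tangent (cotangentModel E) (legendre l) w ξ) =
      -(mfderiv (cotangentModel E) 𝓘(ℝ, ℝ) h (legendre l w)
        (mfderiv 𝓘(ℝ, E).tangent (cotangentModel E) (legendre l) w ξ) : ℝ) := by
  have ht := mem_extChartAt_target (I := 𝓘(ℝ, E).tangent) w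
  rw [tangent_extChartAt_target] at ht
  have hev : ∀ᶠ y in 𝓝 (extChartAt 𝓘(ℝ, E).tangent w w), y.1 ∈ (chartAt E w.1).target :=
    continuous_fst.continuousAt.eventually_mem ((chartAt E w.1).open_target.mem_nhds ht.1)
  have hψ := extChartAt_legendre l (mem_chart_source E w.1)
  obtain ⟨hd, hm⟩ := mfderiv_eq_fderiv_comp_extChartAt
    ((hh (legendre l w)).mdifferentiableAt (by simp))
    (mfderiv 𝓘(ℝ, E).tangent (cotangentModel E) (legendre l) w ξ)
  have hLd : DifferentiableAt ℝ (fun y : E × E => lagrangianInChart l (chartAt E w.1) y.1 y.2)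
      (extChartAt 𝓘(ℝ, E).tangent w w) :=
    ((contDiffOn_lagrangianInChart hl w.1).contDiffAt
      (((chartAt E w.1).open_target.prod isOpen_univ).mem_nhds ht)).differentiableAt (by simp)
  rw [hψ] at hd hm
  have key := fderiv_comp_fiberDerivative hLd
    ((contDiffAt_legendreInChart hl w.1 ht.1).differentiableAt (by simp)) hd
    (Eventually.of_forall fun y => rfl)
    (hev.mono fun y hy => legendreInChart_energy he w hy)
    (mfderiv 𝓘(ℝ, E).tangent 𝓘(ℝ, E × E) (extChartAt 𝓘(ℝ, E).tangent w) w ξ)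
  have hm' := hm.trans ((congrArg _ (mfderiv_extChartAt_mfderiv_legendre hl w ξ)).trans key)
  rw [symplecticForm_apply, hm']
  dsimp only
  rw [hZ, mfderiv_extChartAt_mfderiv_legendre hl w ξ]
  exact (neg_sub _ _).symm

/-! ### The Euler-Lagrange equations in first order form -/

/-- In a chart of `TQ`, the jet of a curve is the pair of its position and its velocity. -/
theorem extChartAt_jet {γ : ℝ → Q} {τ : ℝ} (hγ : MDifferentiableAt 𝓘(ℝ, ℝ) 𝓘(ℝ, E) γ τ)
    (w : TangentBundle 𝓘(ℝ, E) Q) (hs : γ τ ∈ (chartAt E w.1).source) :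
    extChartAt 𝓘(ℝ, E).tangent w (jet γ τ) =
        (chartAt E w.1 (γ τ), deriv (fun σ => chartAt E w.1 (γ σ)) τ) ∧
      DifferentiableAt ℝ (fun σ => chartAt E w.1 (γ σ)) τ := by
  have h := tangentMap_chart (I := 𝓘(ℝ, E)) (p := w) (q := jet γ τ) hs
  have hφ : MDifferentiableAt 𝓘(ℝ, E) 𝓘(ℝ, E) (chartAt E w.1) (γ τ) :=
    mdifferentiableAt_atlas (chart_mem_atlas _ _) hs
  have hc := mfderiv_comp τ hφ hγ
  rw [mfderiv_eq_fderiv] at hc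
  have hd : DifferentiableAt ℝ (fun σ => chartAt E w.1 (γ σ)) τ := (hφ.comp τ hγ).differentiableAt
  refine ⟨?_, hd⟩
  have h1 : extChartAt 𝓘(ℝ, E).tangent w (jet γ τ) = (chartAt E w.1 (γ τ),
      mfderiv 𝓘(ℝ, E) 𝓘(ℝ, E) (chartAt E w.1) (γ τ) (mfderiv 𝓘(ℝ, ℝ) 𝓘(ℝ, E) γ τ (1 : ℝ))) :=
    congrArg (Bundle.TotalSpace.toProd E E) h.symm
  rw [h1]
  exact Prod.ext rfl (congrArg (fun A => A (1 : ℝ)) hc).symm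

/-- The Euler-Lagrange equations in first order form: in the chart about `ℒ(j¹γ(t))`, the velocity
of `ℒ ∘ j¹γ` is `(v, ∂L/∂x)`. -/
theorem IsSolution.hasDerivAt_legendre {l : TangentBundle 𝓘(ℝ, E) Q → ℝ} {γ : ℝ → Q} {I : Set ℝ}
    (hγ : IsSolution l γ I) (hI : IsOpen I) {t : ℝ} (ht : t ∈ I) :
    HasDerivAt
      (fun τ => extChartAt (cotangentModel E) (legendre l (jet (E := E) γ t))
        (legendre l (jet (E := E) γ τ) : CotangentBundle E Q))
      ((extChartAt 𝓘(ℝ, E).tangent (jet (E := E) γ t) (jet (E := E) γ t)).2,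
        fderiv ℝ (fun x => lagrangianInChart l (chartAt E (γ t)) x
          (extChartAt 𝓘(ℝ, E).tangent (jet (E := E) γ t) (jet (E := E) γ t)).2)
          (extChartAt 𝓘(ℝ, E).tangent (jet (E := E) γ t) (jet (E := E) γ t)).1) t := by
  obtain ⟨ht1, ht2⟩ := extChartAt_jet (hγ.mdifferentiableAt hI ht) (jet (E := E) γ t)
    (mem_chart_source E (γ t))
  rw [ht1]
  refine (ht2.hasDerivAt.prodMk (hγ.eulerLagrange (chartAt E (γ t)) (chart_mem_atlas _ _) t ht
    (mem_chart_source E (γ t)))).congr_of_eventuallyEq ?_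
  filter_upwards [hγ.eventually_mem_source hI ht] with τ hτ
  rw [extChartAt_legendre l (w := jet (E := E) γ t) (u := jet (E := E) γ τ) hτ.2,
    (extChartAt_jet (hγ.mdifferentiableAt hI hτ.1) (jet (E := E) γ t) hτ.2).1]
  rfl

end DiracConstraints

open DiracConstraints in
theorem mainTheorem3 {E : Type*} [NormedAddCommGroup E] [NormedSpace ℝ E] [FiniteDimensional ℝ E]
    {Q : Type*} [TopologicalSpace Q] [T2Space Q] [SecondCountableTopology Q] [ChartedSpace E Q]
    [IsManifold 𝓘(ℝ, E) ∞ Q]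
    (l : TangentBundle 𝓘(ℝ, E) Q → ℝ)
    (hl : ContMDiff 𝓘(ℝ, E).tangent 𝓘(ℝ, ℝ) ∞ l)
    (hP : DiracConstraints.IsEmbeddedSubmanifold (DiracConstraints.cotangentModel E)
      (DiracConstraints.primaryConstraintSet l))
    (hsub : DiracConstraints.LegendreIsSubmersion l)
    (h : DiracConstraints.CotangentBundle E Q → ℝ)
    (hh : ContMDiff (DiracConstraints.cotangentModel E) 𝓘(ℝ, ℝ) ∞ h)
    (he : ∀ v : TangentBundle 𝓘(ℝ, E) Q,
      h (DiracConstraints.legendre l v) = DiracConstraints.energy l v)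
    (γ : ℝ → Q) (I : Set ℝ) (hIopen : IsOpen I) (hIint : I.OrdConnected)
    (hγ : DiracConstraints.IsSolution l γ I)
    (f : DiracConstraints.CotangentBundle E Q → ℝ)
    (hf : DiracConstraints.IsFirstClass l f) :
    ∀ t ∈ I, HasDerivAt
      (fun s : ℝ => f (DiracConstraints.legendre l (DiracConstraints.jet γ s)))
      (DiracConstraints.poissonBracket f h
        (DiracConstraints.legendre l (DiracConstraints.jet γ t))) t := by
  intro t ht
  have : T2Space (CotangentBundle E Q) := t2Space_totalSpace
  set w : TangentBundle 𝓘(ℝ, E) Q := jet γ t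
  set a : CotangentBundle E Q := legendre l w
  have hder := hγ.hasDerivAt_legendre hIopen ht
  -- `Z` is the velocity at time `t` of the curve `ℒ ∘ j¹γ`, and `X` is `X_h`.
  obtain ⟨Z, hZ⟩ := exists_mfderiv_extChartAt_eq (J := cotangentModel E) a
    ((extChartAt 𝓘(ℝ, E).tangent w w).2,
      fderiv ℝ (fun x => lagrangianInChart l (chartAt E w.1) x
        (extChartAt 𝓘(ℝ, E).tangent w w).2) (extChartAt 𝓘(ℝ, E).tangent w w).1)
  obtain ⟨X, hX⟩ := exists_isHamiltonianVectorAt h a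
  obtain ⟨η, hη⟩ := exists_continuousLinearMap_eq_symplecticForm a (Z - X)
  -- `(Z - X) ⌟ ω` vanishes on `T_a 𝒫`, so that `Z - X` is the Hamiltonian vector at `a` of some
  -- function `c` vanishing on `𝒫`.
  obtain ⟨c, hc, hcP, hca⟩ := hP.exists_contMDiff_eq_zero (p := a) ⟨w, rfl⟩ (-η) (by
    intro v hv
    rw [← hsub w] at hv
    obtain ⟨ξ, rfl⟩ := hv
    have h1 := symplecticForm_mfderiv_legendre hl hh he w hZ ξ
    have h2 := hX (mfderiv 𝓘(ℝ, E).tangent (cotangentModel E) (legendre l) w ξ)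
    rw [neg_apply, hη, symplecticForm_sub_left, h1.trans h2.symm, sub_self, neg_zero])
  have hcC : IsConstraintFunction l c :=
    ⟨hc, fun b hb => hcP b (by obtain ⟨v, -, rfl⟩ := hb; exact ⟨v, rfl⟩)⟩
  have hY : IsHamiltonianVectorAt c a (Z - X) := fun v => by
    rw [hca, ← hη]; exact (neg_neg _).symm
  have h0 : poissonBracket f c a = 0 :=
    (hf.2 c hcC).2 a ⟨w, hγ.jet_mem_initialDataConstraint hIopen ht, rfl⟩
  rw [hY.poissonBracket_eq, map_sub] at h0
  have hZX : mfderiv (cotangentModel E) 𝓘(ℝ, ℝ) f a Z = mfderiv (cotangentModel E) 𝓘(ℝ, ℝ) f a X :=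
    sub_eq_zero.1 h0
  rw [hX.poissonBracket_eq, ← hZX]
  obtain ⟨hd, hm⟩ := mfderiv_eq_fderiv_comp_extChartAt ((hf.1 a).mdifferentiableAt (by simp)) Z
  rw [hm, hZ]
  have hfin := hd.hasFDerivAt.comp_hasDerivAt t hder
  refine hfin.congr_of_eventuallyEq ?_
  filter_upwards [hγ.eventually_mem_source hIopen ht] with τ hτ
  simp only [Function.comp_apply]
  rw [(extChartAt (cotangentModel E) _).left_inv]
  rw [cotangent_extChartAt_source]
  exact hτ.2
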